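/- Let $d\ge 1$. Equip $\mathbb C^d$ with its standard inner product and with the Gaussian probability measure $d\mu_d(\xi)=\pi^{-d}e^{-\|\xi\|^2}\,dV_d(\xi)$, where $V_d$ is the $2d$-dimensional Lebesgue measure. Let $\mathcal B_d$ be the Segal–Bargmann space, that is, the Hilbert space of all entire functions $f\colon\mathbb C^d\to\mathbb C$ that belong to $L^2(\mu_d)$, with the norm and inner product of $L^2(\mu_d)$. For a holomorphic map $\varphi\colon\mathbb C^d\to\mathbb C^d$ let $C_\varphi$ be the composition operator in $\mathcal B_d$ with domain $\{f\in\mathcal B_d: f\circ\varphi\in\mathcal B_d\}$, given by $C_\varphi f=f\circ\varphi$. Write $C_\varphi\in\boldsymbol B(\mathcal B_d)$ if this domain is all of $\mathcal B_d$ and $C_\varphi$ is bounded. Let $r(T)$ be the spectral radius of a bounded operator $T$, and call $T$ normaloid if $r(T)=\|T\|$. (1) If $\varphi\colon\mathbb C^d\to\mathbb C^d$ is holomorphic and $C_\varphi\in\boldsymbol B(\mathcal B_d)$, then $r(C_\varphi)=1$. (2) Let $\varphi(z)=Az+b$ for $z\in\mathbb C^d$, where $A\colon\mathbb C^d\to\mathbb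 C^d$ is linear and $b\in\mathbb C^d$, and assume that $C_\varphi\in\boldsymbol B(\mathcal B_d)$. Then $C_\varphi$ is normaloid if and only if $b=0$. Moreover, if $C_\varphi$ is normaloid, then $r(C_\varphi)=\|C_\varphi\|=1$. -/

import Mathlib

open MeasureTheory
open scoped ENNReal

noncomputable section

namespace SegalBargmann

/-- The `2d`-dimensional Lebesgue measure `V_d` on `ℂ^d`, where `ℂ^d` carries the standard inner
product (`EuclideanSpace ℂ (Fin d)`): the product of the planar Lebesgue measures. -/
def lebesgueMeasure (d : ℕ) : Measure (EuclideanSpace ℂ (Fin d)) :=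
  (volume : Measure (Fin d → ℂ)).map (WithLp.toLp 2)

/-- The Gaussian measure `dμ_d = π^{-d} exp(-‖ξ‖²) dV_d` on `ℂ^d`. -/
def gaussianMeasure (d : ℕ) : Measure (EuclideanSpace ℂ (Fin d)) :=
  (lebesgueMeasure d).withDensity
    (fun ξ => ENNReal.ofReal (Real.exp (-‖ξ‖ ^ 2) / Real.pi ^ d))

/-- The vector space of entire functions on `ℂ^d` which are square integrable with respect to the
Gaussian measure. -/
def entireL2 (d : ℕ) : Submodule ℂ (EuclideanSpace ℂ (Fin d) → ℂ) where
  carrier := {f | Differentiable ℂ f ∧ MemLp f 2 (gaussianMeasure d)}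
  add_mem' hf hg := ⟨hf.1.add hg.1, hf.2.add hg.2⟩
  zero_mem' := ⟨differentiable_const 0, MemLp.zero⟩
  smul_mem' c _ hf := ⟨hf.1.const_smul c, hf.2.const_smul c⟩

/-- The Segal-Bargmann space `𝓑_d` of order `d`.  It is a type of its own, and not a subtype of a
function space, in order that its topology is the one of the `L²(μ_d)` norm below and not the
topology of pointwise convergence. -/
def Space (d : ℕ) : Type := entireL2 d

instance (d : ℕ) : AddCommGroup (Space d) := inferInstanceAs (AddCommGroup (entireL2 d))

instance (d : ℕ) : Module ℂ (Space d) := inferInstanceAs (Module ℂ (entireL2 d))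

/-- The elements of `𝓑_d` are functions on `ℂ^d`. -/
instance (d : ℕ) : CoeFun (Space d) (fun _ => EuclideanSpace ℂ (Fin d) → ℂ) := ⟨fun f => f.1⟩

theorem Space.ext {d : ℕ} {f g : Space d} (h : ∀ z, f z = g z) : f = g :=
  Subtype.ext (funext h)

instance (d : ℕ) : (lebesgueMeasure d).IsOpenPosMeasure :=
  (PiLp.continuous_toLp 2 (fun _ : Fin d => ℂ)).isOpenPosMeasure_map
    (WithLp.toLp_surjective 2)

instance (d : ℕ) : (gaussianMeasure d).IsOpenPosMeasure := by
  refine Measure.AbsolutelyContinuous.isOpenPosMeasure (μ := lebesgueMeasure d) ?_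
  refine withDensity_absolutelyContinuous' (by fun_prop) (Filter.Eventually.of_forall fun ξ => ?_)
  have : 0 < Real.exp (-‖ξ‖ ^ 2) / Real.pi ^ d := by positivity
  simpa using this

/-- The inclusion `𝓑_d → L²(μ_d)`. -/
def toL2 (d : ℕ) : Space d →ₗ[ℂ] Lp ℂ 2 (gaussianMeasure d) where
  toFun f := f.2.2.toLp f.1
  map_add' f g := MemLp.toLp_add f.2.2 g.2.2
  map_smul' c f := MemLp.toLp_const_smul c f.2.2

theorem toL2_injective (d : ℕ) : Function.Injective (toL2 d) := by
  intro f g h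
  have h' : f.1 =ᵐ[gaussianMeasure d] g.1 := (MemLp.toLp_eq_toLp_iff f.2.2 g.2.2).1 h
  exact Subtype.ext ((f.2.1.continuous.ae_eq_iff_eq _ g.2.1.continuous).1 h')

/-- The norm of `𝓑_d` is the norm of `L²(μ_d)`. -/
instance (d : ℕ) : NormedAddCommGroup (Space d) :=
  NormedAddCommGroup.induced (Space d) (Lp ℂ 2 (gaussianMeasure d)) (toL2 d) (toL2_injective d)

/-- The inner product of `𝓑_d` is the inner product of `L²(μ_d)`. -/
instance (d : ℕ) : InnerProductSpace ℂ (Space d) :=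
  { NormedSpace.induced ℂ (Space d) (Lp ℂ 2 (gaussianMeasure d)) (toL2 d) with
    inner := fun f g => inner ℂ (toL2 d f) (toL2 d g)
    add_left := fun f g h => by simp only [map_add, inner_add_left]
    smul_left := fun f g c => by simp only [map_smul, inner_smul_left]
    norm_sq_eq_re_inner := fun f => norm_sq_eq_re_inner (𝕜 := ℂ) (toL2 d f)
    conj_inner_symm := fun f g => inner_conj_symm (toL2 d f) (toL2 d g) }

/-- The composition operator `C_φ` in `𝓑_d` with symbol `φ`, a partially defined operator with
domain `{f ∈ 𝓑_d : f ∘ φ ∈ 𝓑_d}`, given by `C_φ f = f ∘ φ`. -/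
def compOp {d : ℕ} (φ : EuclideanSpace ℂ (Fin d) → EuclideanSpace ℂ (Fin d)) :
    Space d →ₗ.[ℂ] Space d where
  domain :=
    { carrier := {f | (fun z => f (φ z)) ∈ entireL2 d}
      add_mem' := fun hf hg => (entireL2 d).add_mem hf hg
      zero_mem' := (entireL2 d).zero_mem
      smul_mem' := fun c _ hf => (entireL2 d).smul_mem c hf }
  toFun :=
    { toFun := fun f => ⟨fun z => f.1 (φ z), f.2⟩
      map_add' := fun _ _ => rfl
      map_smul' := fun _ _ => rfl }

/-- The bounded operator `T`, defined on the whole space, is the composition operator `C_φ`; so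
`C_φ` is a bounded operator on `𝓑_d` if and only if such a `T` exists. -/
def IsCompOp {d : ℕ} (φ : EuclideanSpace ℂ (Fin d) → EuclideanSpace ℂ (Fin d))
    (T : Space d →L[ℂ] Space d) : Prop :=
  compOp φ = (T : Space d →ₗ[ℂ] Space d).toPMap ⊤

/-- A bounded operator is normaloid if its spectral radius equals its norm. -/
def IsNormaloid {E : Type*} [NormedAddCommGroup E] [NormedSpace ℂ E] (T : E →L[ℂ] E) : Prop :=
  spectralRadius ℂ T = ‖T‖ₑ

end SegalBargmann

end

noncomputable section

namespace SegalBargmann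

variable {d : ℕ}

/-! The functions `kernel z` reproduce point values, span a dense subspace, and satisfy `‖kernel z‖
^ 2 = exp (‖z‖ ^ 2)`. The adjoint of `C_φ` sends `kernel z` to `kernel (φ z)`, so boundedness of
`C_φ` forces `‖φ z‖ ^ 2 ≤ ‖z‖ ^ 2 + M` (`norm_sq_apply_le`). By Liouville `φ` is then affine.

Conversely, such an inequality for an affine symbol gives `‖C_φ‖ ^ 2 ≤ exp M` (`norm_sq_le_exp`):
`C_φ C_φ*` is self-adjoint and maps kernels to multiples of kernels, and its norm can be read off
from the growth of orbits on a dense subspace.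

For `φ z = A z + b` the inequality makes `A` a contraction and puts `b` orthogonal to the subspace
where all powers of `A` are isometric. On the complement of that subspace high powers of `A`
contract uniformly, and `φ` has a fixed point there. Hence one constant serves all large iterates of
`φ` (`exists_norm_sq_iterate_le`), the powers of `C_φ` are bounded, and the spectral radius is at
most 1. It is at least 1 because constants are fixed.

Normaloid therefore means norm 1. If `b = 0` the norm bound applies with `M = 0`; if the norm is 1,
the adjoint at `kernel 0` gives `exp (‖b‖ ^ 2) ≤ 1`. -/

/-! ### Gaussian measure: invariance and integrability -/

theorem measurePreserving_toLp_lebesgueMeasure (d : ℕ) :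
    MeasurePreserving (MeasurableEquiv.toLp 2 (Fin d → ℂ)) volume (lebesgueMeasure d) :=
  ⟨MeasurableEquiv.measurable _, rfl⟩

theorem measurePreserving_add_right_lebesgueMeasure (a : EuclideanSpace ℂ (Fin d)) :
    MeasurePreserving (· + a) (lebesgueMeasure d) (lebesgueMeasure d) := by
  have e := measurePreserving_toLp_lebesgueMeasure d
  have h : MeasurePreserving (· + a.ofLp) (volume : Measure (Fin d → ℂ)) volume :=
    measurePreserving_add_right _ _
  have := (e.comp h).comp (e.symm _)
  exact this

theorem measurePreserving_smul_lebesgueMeasure (c : Circle) :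
    MeasurePreserving (fun ξ => (c : ℂ) • ξ) (lebesgueMeasure d) (lebesgueMeasure d) := by
  have e := measurePreserving_toLp_lebesgueMeasure d
  have h : MeasurePreserving (fun (x : Fin d → ℂ) i => (rotation c) (x i)) volume volume :=
    volume_preserving_pi fun _ => (rotation c).measurePreserving
  have := (e.comp h).comp (e.symm _)
  exact this

theorem integral_exp_neg_mul_sq_norm {c : ℝ} (hc : 0 < c) :
    ∫ ξ, Real.exp (-c * ‖ξ‖ ^ 2) ∂(lebesgueMeasure d) = (Real.pi / c) ^ d := by
  rw [← (measurePreserving_toLp_lebesgueMeasure d).integral_comp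
    (MeasurableEquiv.measurableEmbedding _)]
  have h : ∀ x : Fin d → ℂ, Real.exp (-c * ‖MeasurableEquiv.toLp 2 (Fin d → ℂ) x‖ ^ 2) =
      ∏ i, Real.exp (-c * ‖x i‖ ^ 2) := by
    intro x
    rw [← Real.exp_sum, ← Finset.mul_sum, EuclideanSpace.norm_sq_eq]
    rfl
  simp_rw [h]
  rw [integral_fintype_prod_volume_eq_prod (fun (_ : Fin d) (z : ℂ) => Real.exp (-c * ‖z‖ ^ 2))]
  simp [GaussianFourier.integral_rexp_neg_mul_sq_norm hc, -neg_mul, div_pow]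

theorem integrable_exp_neg_mul_sq_norm {c : ℝ} (hc : 0 < c) :
    Integrable (fun ξ => Real.exp (-c * ‖ξ‖ ^ 2)) (lebesgueMeasure d) := by
  refine Integrable.of_integral_ne_zero ?_
  rw [integral_exp_neg_mul_sq_norm hc]
  positivity

theorem measurable_gaussianDensity (d : ℕ) :
    Measurable fun ξ : EuclideanSpace ℂ (Fin d) =>
      ENNReal.ofReal (Real.exp (-‖ξ‖ ^ 2) / Real.pi ^ d) := by
  fun_prop

theorem integral_gaussianMeasure {E : Type*} [NormedAddCommGroup E] [NormedSpace ℝ E]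
    (f : EuclideanSpace ℂ (Fin d) → E) :
    ∫ ξ, f ξ ∂(gaussianMeasure d) =
      ∫ ξ, (Real.exp (-‖ξ‖ ^ 2) / Real.pi ^ d) • f ξ ∂(lebesgueMeasure d) := by
  rw [gaussianMeasure, integral_withDensity_eq_integral_toReal_smul (measurable_gaussianDensity d)
    (Filter.Eventually.of_forall fun _ => ENNReal.ofReal_lt_top)]
  refine integral_congr_ae (Filter.Eventually.of_forall fun ξ => ?_)
  simp only
  rw [ENNReal.toReal_ofReal (by positivity)]

theorem integrable_gaussianMeasure_iff {E : Type*} [NormedAddCommGroup E] [NormedSpace ℝ E]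
    {f : EuclideanSpace ℂ (Fin d) → E} :
    Integrable f (gaussianMeasure d) ↔
      Integrable (fun ξ => (Real.exp (-‖ξ‖ ^ 2) / Real.pi ^ d) • f ξ) (lebesgueMeasure d) := by
  rw [gaussianMeasure, integrable_withDensity_iff_integrable_smul' (measurable_gaussianDensity d)
    (Filter.Eventually.of_forall fun _ => ENNReal.ofReal_lt_top)]
  refine integrable_congr (Filter.Eventually.of_forall fun ξ => ?_)
  simp only
  rw [ENNReal.toReal_ofReal (by positivity)]

theorem integral_one_gaussianMeasure : ∫ _, (1 : ℝ) ∂(gaussianMeasure d) = 1 := by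
  rw [integral_gaussianMeasure]
  have := integral_exp_neg_mul_sq_norm (d := d) one_pos
  simp only [neg_mul, one_mul, div_one] at this
  simp only [smul_eq_mul, mul_one, integral_div, this]
  exact div_self (by positivity)

instance : IsProbabilityMeasure (gaussianMeasure d) := by
  have h : (gaussianMeasure d).real Set.univ = 1 := by
    simpa using integral_one_gaussianMeasure (d := d)
  refine ⟨?_⟩
  rw [Measure.real] at h
  exact (ENNReal.toReal_eq_one_iff _).1 h

theorem integrable_exp_mul_norm (C : ℝ) :
    Integrable (fun ξ => Real.exp (C * ‖ξ‖)) (gaussianMeasure d) := by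
  rw [integrable_gaussianMeasure_iff]
  -- Half of the Gaussian exponent absorbs the linear term: `C‖ξ‖ ≤ ‖ξ‖ ^ 2 / 2 + C ^ 2 / 2`.
  refine ((integrable_exp_neg_mul_sq_norm (d := d) (half_pos one_pos)).const_mul
    (Real.exp (C ^ 2 / 2) / Real.pi ^ d)).mono' ?_ (Filter.Eventually.of_forall fun ξ => ?_)
  · exact Continuous.aestronglyMeasurable (by fun_prop)
  · rw [Real.norm_of_nonneg (by positivity), smul_eq_mul, div_mul_eq_mul_div, div_mul_eq_mul_div,
      ← Real.exp_add, ← Real.exp_add]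
    refine div_le_div_of_nonneg_right (Real.exp_le_exp.2 ?_) (by positivity)
    nlinarith [sq_nonneg (‖ξ‖ - C)]

theorem memLp_exp_mul_norm (C : ℝ) :
    MemLp (fun ξ => Real.exp (C * ‖ξ‖)) 2 (gaussianMeasure d) := by
  rw [memLp_two_iff_integrable_sq (Continuous.aestronglyMeasurable (by fun_prop))]
  refine (integrable_exp_mul_norm (d := d) (2 * C)).congr (Filter.Eventually.of_forall fun ξ => ?_)
  simp only
  rw [← Real.exp_nat_mul]
  congr 1
  push_cast
  ring

theorem integral_smul_gaussianMeasure {E : Type*} [NormedAddCommGroup E] [NormedSpace ℝ E]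
    (f : EuclideanSpace ℂ (Fin d) → E) (c : Circle) :
    ∫ ξ, f ((c : ℂ) • ξ) ∂(gaussianMeasure d) = ∫ ξ, f ξ ∂(gaussianMeasure d) := by
  rw [integral_gaussianMeasure, integral_gaussianMeasure,
    ← (measurePreserving_smul_lebesgueMeasure c).integral_comp
      (measurableEmbedding_const_smul₀ (Circle.coe_ne_zero c))
      (fun ξ => (Real.exp (-‖ξ‖ ^ 2) / Real.pi ^ d) • f ξ)]
  simp only [norm_smul, Circle.norm_coe, one_mul]

theorem integrable_smul_gaussianMeasure_iff {E : Type*} [NormedAddCommGroup E] [NormedSpace ℝ E]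
    {f : EuclideanSpace ℂ (Fin d) → E} (c : Circle) :
    Integrable (fun ξ => f ((c : ℂ) • ξ)) (gaussianMeasure d) ↔
      Integrable f (gaussianMeasure d) := by
  rw [integrable_gaussianMeasure_iff, integrable_gaussianMeasure_iff,
    ← (measurePreserving_smul_lebesgueMeasure c).integrable_comp_emb
      (measurableEmbedding_const_smul₀ (Circle.coe_ne_zero c))
      (g := fun ξ => (Real.exp (-‖ξ‖ ^ 2) / Real.pi ^ d) • f ξ)]
  simp only [norm_smul, Circle.norm_coe, one_mul, Function.comp_def]

/-! ### Mean value property and reproducing kernel -/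

/-- The mean value property of entire functions with respect to the Gaussian measure. -/
theorem integral_gaussianMeasure_eq_apply_zero {f : EuclideanSpace ℂ (Fin d) → ℂ}
    (hf : Differentiable ℂ f) (hi : Integrable f (gaussianMeasure d)) :
    ∫ ξ, f ξ ∂(gaussianMeasure d) = f 0 := by
  have hcm : ∀ θ : ℝ, circleMap 0 1 θ = (Circle.exp θ : ℂ) := fun θ => by simp [circleMap]
  have hmean : ∀ ξ, ∫ θ in (0 : ℝ)..2 * Real.pi, f ((Circle.exp θ : ℂ) • ξ) =
      (2 * Real.pi : ℝ) • f 0 := by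
    intro ξ
    have hd : Differentiable ℂ fun t : ℂ => f (t • ξ) := hf.comp (by fun_prop)
    have h := (hd.diffContOnCl (s := Metric.ball 0 |1|)).circleAverage
    rw [Real.circleAverage_def, inv_smul_eq_iff₀ (by positivity)] at h
    simpa [hcm] using h
  -- Fubini over rotations: the integral over `ξ` does not depend on `θ` by rotation invariance, and
  -- the integral over `θ` does not depend on `ξ` by the mean value property on circles.
  have hswap : Integrable
      (Function.uncurry fun (θ : ℝ) ξ => f ((Circle.exp θ : ℂ) • ξ))
      ((volume.restrict (Set.Ioc 0 (2 * Real.pi))).prod (gaussianMeasure d)) := by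
    rw [integrable_prod_iff]
    · refine ⟨Filter.Eventually.of_forall fun θ =>
        (integrable_smul_gaussianMeasure_iff (Circle.exp θ)).2 hi, ?_⟩
      simp only [Function.uncurry_apply_pair, integral_smul_gaussianMeasure (fun ξ => ‖f ξ‖)]
      exact integrable_const _
    · refine Continuous.aestronglyMeasurable ?_
      exact hf.continuous.comp (by fun_prop)
  have h := integral_integral_swap hswap
  simp only [integral_smul_gaussianMeasure f] at h
  simp only [← intervalIntegral.integral_of_le Real.two_pi_pos.le, hmean] at h
  simpa [Real.pi_ne_zero] using h

theorem norm_exp_inner_le (z w : EuclideanSpace ℂ (Fin d)) :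
    ‖Complex.exp (inner ℂ z w)‖ ≤ Real.exp (‖z‖ * ‖w‖) := by
  rw [Complex.norm_exp]
  exact Real.exp_le_exp.2 ((Complex.re_le_norm _).trans (norm_inner_le_norm z w))

theorem memLp_exp_inner (z : EuclideanSpace ℂ (Fin d)) :
    MemLp (fun w => Complex.exp (inner ℂ z w)) 2 (gaussianMeasure d) := by
  refine (memLp_exp_mul_norm (d := d) ‖z‖).mono
    (Continuous.aestronglyMeasurable (by fun_prop)) (Filter.Eventually.of_forall fun w => ?_)
  rw [Real.norm_of_nonneg (Real.exp_pos _).le]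
  exact norm_exp_inner_le z w

theorem memLp_exp_inner_left (z : EuclideanSpace ℂ (Fin d)) :
    MemLp (fun w => Complex.exp (inner ℂ w z)) 2 (gaussianMeasure d) := by
  refine (memLp_exp_mul_norm (d := d) ‖z‖).mono
    (Continuous.aestronglyMeasurable (by fun_prop)) (Filter.Eventually.of_forall fun w => ?_)
  rw [Real.norm_of_nonneg (Real.exp_pos _).le, mul_comm]
  exact norm_exp_inner_le w z

/-- Translating by `z` and completing the square turns the integrand into the holomorphic function
`f (w + z) * exp (-⟪z, w⟫)` against the Gaussian weight; its value at 0 is `f z`. -/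
theorem integral_mul_exp_inner {f : EuclideanSpace ℂ (Fin d) → ℂ} (hf : Differentiable ℂ f)
    (hm : MemLp f 2 (gaussianMeasure d)) (z : EuclideanSpace ℂ (Fin d)) :
    ∫ w, f w * Complex.exp (inner ℂ w z) ∂(gaussianMeasure d) = f z := by
  have hi : Integrable (fun w => f w * Complex.exp (inner ℂ w z)) (gaussianMeasure d) :=
    hm.integrable_mul (memLp_exp_inner_left z)
  have key : ∀ w, (Real.exp (-‖w + z‖ ^ 2) / Real.pi ^ d) •
      (f (w + z) * Complex.exp (inner ℂ (w + z) z)) =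
      (Real.exp (-‖w‖ ^ 2) / Real.pi ^ d) • (f (w + z) * Complex.exp (-inner ℂ z w)) := by
    intro w
    have h : Complex.exp (-(‖w + z‖ : ℂ) ^ 2) * Complex.exp (inner ℂ (w + z) z) =
        Complex.exp (-(‖w‖ : ℂ) ^ 2) * Complex.exp (-inner ℂ z w) := by
      rw [← Complex.exp_add, ← Complex.exp_add]
      congr 1
      have h1 := inner_self_eq_norm_sq_to_K (𝕜 := ℂ) (w + z)
      have h2 := inner_self_eq_norm_sq_to_K (𝕜 := ℂ) w
      simp only [Complex.coe_algebraMap] at h1 h2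
      rw [← h1, ← h2]
      simp only [inner_add_left, inner_add_right]
      ring
    simp only [Complex.real_smul]
    push_cast
    linear_combination (f (w + z) / (Real.pi : ℂ) ^ d) * h
  have hi' : Integrable (fun w => f (w + z) * Complex.exp (-inner ℂ z w)) (gaussianMeasure d) := by
    rw [integrable_gaussianMeasure_iff] at hi ⊢
    rw [← (measurePreserving_add_right_lebesgueMeasure z).integrable_comp_emb
      (measurableEmbedding_addRight z)] at hi
    exact hi.congr (Filter.Eventually.of_forall key)
  have hd : Differentiable ℂ fun w => f (w + z) * Complex.exp (-inner ℂ z w) := by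
    have : (fun w => f (w + z) * Complex.exp (-inner ℂ z w)) =
      fun w => f (w + z) * Complex.exp (-(innerSL ℂ z) w) := rfl
    rw [this]
    fun_prop
  rw [integral_gaussianMeasure, ← (measurePreserving_add_right_lebesgueMeasure z).integral_comp
      (measurableEmbedding_addRight z)]
  simp only [key]
  rw [← integral_gaussianMeasure fun w => f (w + z) * Complex.exp (-inner ℂ z w),
    integral_gaussianMeasure_eq_apply_zero hd hi']
  simp

/-- The reproducing kernel `w ↦ exp ⟪w, z⟫` of the Segal-Bargmann space. -/
def kernel (z : EuclideanSpace ℂ (Fin d)) : Space d :=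
  ⟨fun w => Complex.exp (inner ℂ z w),
    (Complex.differentiable_exp.comp (innerSL ℂ z).differentiable :
      Differentiable ℂ fun w => Complex.exp ((innerSL ℂ z) w)), memLp_exp_inner z⟩

theorem kernel_apply (z w : EuclideanSpace ℂ (Fin d)) :
    kernel z w = Complex.exp (inner ℂ z w) := rfl

theorem coeFn_toL2 (f : Space d) : toL2 d f =ᵐ[gaussianMeasure d] f.1 := f.2.2.coeFn_toLp

theorem inner_toL2_kernel (z : EuclideanSpace ℂ (Fin d)) (g : Lp ℂ 2 (gaussianMeasure d)) :
    inner ℂ (toL2 d (kernel z)) g =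
      ∫ w, g w * Complex.exp (inner ℂ w z) ∂(gaussianMeasure d) := by
  rw [L2.inner_def]
  refine integral_congr_ae ?_
  filter_upwards [coeFn_toL2 (kernel z)] with w hw
  rw [hw, RCLike.inner_apply]
  change g w * (starRingEnd ℂ) (Complex.exp (inner ℂ z w)) = _
  rw [← Complex.exp_conj, inner_conj_symm]

theorem inner_kernel (z : EuclideanSpace ℂ (Fin d)) (f : Space d) :
    inner ℂ (kernel z) f = f z := by
  change inner ℂ (toL2 d (kernel z)) (toL2 d f) = f z
  rw [inner_toL2_kernel, ← integral_mul_exp_inner f.2.1 f.2.2 z]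
  refine integral_congr_ae ?_
  filter_upwards [coeFn_toL2 f] with w hw
  rw [hw]

theorem norm_kernel_sq (z : EuclideanSpace ℂ (Fin d)) :
    ‖kernel z‖ ^ 2 = Real.exp (‖z‖ ^ 2) := by
  have h := inner_self_eq_norm_sq_to_K (𝕜 := ℂ) (kernel z)
  rw [inner_kernel, kernel_apply, inner_self_eq_norm_sq_to_K] at h
  simp only [Complex.coe_algebraMap] at h
  exact_mod_cast h.symm

/-! ### Completeness and density of kernels -/

theorem isometry_toL2 (d : ℕ) : Isometry (toL2 d) :=
  AddMonoidHomClass.isometry_of_norm (toL2 d) fun _ => rfl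

theorem differentiable_integral_mul_exp_inner (g : Lp ℂ 2 (gaussianMeasure d)) :
    Differentiable ℂ fun z => ∫ w, g w * Complex.exp (inner ℂ w z) ∂(gaussianMeasure d) := by
  intro z₀
  have hg : MemLp g 2 (gaussianMeasure d) := Lp.memLp g
  -- In the exponent `‖z₀‖ + 2`, one unit covers the ball around `z₀` and the other absorbs the
  -- factor `‖w‖ ≤ exp ‖w‖` from the derivative.
  have hbd := hg.norm.integrable_mul (memLp_exp_mul_norm (d := d) (‖z₀‖ + 2))
  have hmeas : ∀ z, AEStronglyMeasurable (fun w => g w * Complex.exp (inner ℂ w z))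
      (gaussianMeasure d) := fun z =>
    hg.1.mul (Continuous.aestronglyMeasurable (by fun_prop))
  refine (hasFDerivAt_integral_of_dominated_of_fderiv_le
    (F' := fun z w => (g w * Complex.exp (inner ℂ w z)) • innerSL ℂ w)
    (Metric.ball_mem_nhds z₀ one_pos) (Filter.Eventually.of_forall hmeas)
    (hg.integrable_mul (memLp_exp_inner_left z₀)) ?_ (Filter.Eventually.of_forall fun w z hz => ?_)
    hbd (Filter.Eventually.of_forall fun w z _ => ?_)).differentiableAt
  · exact (hmeas z₀).smul (innerSL ℂ).continuous.aestronglyMeasurable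
  · have hz' : ‖z‖ ≤ ‖z₀‖ + 1 := by
      have := norm_sub_norm_le z z₀
      rw [mem_ball_iff_norm] at hz
      linarith
    rw [norm_smul, innerSL_apply_norm, norm_mul]
    simp only [Pi.mul_apply]
    rw [mul_assoc]
    gcongr
    calc ‖Complex.exp (inner ℂ w z)‖ * ‖w‖
        ≤ Real.exp (‖w‖ * (‖z₀‖ + 1)) * Real.exp ‖w‖ := by
          gcongr
          · exact (norm_exp_inner_le w z).trans (Real.exp_le_exp.2 (by gcongr))
          · linarith [Real.add_one_le_exp ‖w‖]
      _ = Real.exp ((‖z₀‖ + 2) * ‖w‖) := by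
          rw [← Real.exp_add]
          ring_nf
  · have h1 : HasFDerivAt (fun z => inner ℂ w z) (innerSL ℂ w) z := (innerSL ℂ w).hasFDerivAt
    have := h1.cexp.const_mul (g w)
    rwa [smul_smul] at this

/-- Pairing an `L²` limit `g` with the kernels produces an entire function `F`, the pointwise limit
of the sequence. A subsequence also converges almost everywhere to `g`, so `g = F` almost
everywhere. -/
theorem isClosed_range_toL2 (d : ℕ) : IsClosed (Set.range (toL2 d)) := by
  refine IsSeqClosed.isClosed fun u g hu hlim => ?_
  choose f hf using hu
  set F : EuclideanSpace ℂ (Fin d) → ℂ :=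
    fun z => ∫ w, g w * Complex.exp (inner ℂ w z) ∂(gaussianMeasure d) with hF
  have hpt : ∀ z, Filter.Tendsto (fun n => f n z) Filter.atTop (nhds (F z)) := by
    intro z
    have h := Filter.Tendsto.inner (𝕜 := ℂ) (tendsto_const_nhds (x := toL2 d (kernel z))) hlim
    rw [inner_toL2_kernel] at h
    refine h.congr fun n => ?_
    rw [← hf n]
    exact inner_kernel z (f n)
  obtain ⟨ns, hns, hae⟩ := (tendstoInMeasure_of_tendsto_Lp hlim).exists_seq_tendsto_ae
  have hgF : g =ᵐ[gaussianMeasure d] F := by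
    have hall : ∀ᵐ w ∂(gaussianMeasure d), ∀ n, u n w = f n w :=
      ae_all_iff.2 fun n => by
        rw [← hf n]
        exact coeFn_toL2 (f n)
    filter_upwards [hae, hall] with w hw h
    refine tendsto_nhds_unique hw ?_
    simp only [h]
    exact (hpt w).comp hns.tendsto_atTop
  have hmem : MemLp F 2 (gaussianMeasure d) := (Lp.memLp g).ae_eq hgF
  refine ⟨⟨F, differentiable_integral_mul_exp_inner g, hmem⟩, ?_⟩
  exact Lp.ext ((coeFn_toL2 _).trans hgF.symm)

instance : CompleteSpace (Space d) :=
  (completeSpace_iff_isComplete_range (isometry_toL2 d).isUniformInducing).2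
    (isClosed_range_toL2 d).isComplete

theorem dense_span_range_kernel (d : ℕ) :
    Dense (Submodule.span ℂ (Set.range (kernel (d := d))) : Set (Space d)) := by
  rw [Submodule.dense_iff_topologicalClosure_eq_top, Submodule.topologicalClosure_eq_top_iff,
    Submodule.eq_bot_iff]
  intro f hf
  refine Space.ext fun z => ?_
  rw [← inner_kernel]
  exact hf _ (Submodule.subset_span ⟨z, rfl⟩)

/-! ### Norms of self-adjoint operators from orbit growth -/

section Hilbert

variable {H : Type*} [NormedAddCommGroup H] [InnerProductSpace ℂ H] [CompleteSpace H]

theorem norm_apply_sq_le_of_isSelfAdjoint {Q : H →L[ℂ] H} (hQ : IsSelfAdjoint Q) (x : H) :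
    ‖Q x‖ ^ 2 ≤ ‖(Q ^ 2) x‖ * ‖x‖ := by
  have h : inner ℂ ((Q ^ 2) x) x = inner ℂ (Q x) (Q x) := by
    rw [pow_two, mul_apply_eq_comp, ← ContinuousLinearMap.adjoint_inner_right,
      hQ.adjoint_eq]
  have h2 := norm_inner_le_norm (𝕜 := ℂ) ((Q ^ 2) x) x
  rw [h] at h2
  simpa [pow_two] using h2

/-- Repeated Cauchy–Schwarz, applied to the self-adjoint powers `P ^ 2 ^ k`. The form without
division also covers `x = 0`. -/
theorem norm_apply_pow_two_pow_le {P : H →L[ℂ] H} (hP : IsSelfAdjoint P) (x : H) (k : ℕ) :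
    ‖P x‖ ^ 2 ^ k * ‖x‖ ≤ ‖(P ^ 2 ^ k) x‖ * ‖x‖ ^ 2 ^ k := by
  induction k with
  | zero => simp
  | succ k ih =>
    rcases (norm_nonneg x).eq_or_lt with hx | hx
    · rw [← hx]
      simp
    · refine le_of_mul_le_mul_right ?_ hx
      have h2 := norm_apply_sq_le_of_isSelfAdjoint (hP.pow (2 ^ k)) x
      rw [← pow_mul, ← pow_succ] at h2
      calc ‖P x‖ ^ 2 ^ (k + 1) * ‖x‖ * ‖x‖ = (‖P x‖ ^ 2 ^ k * ‖x‖) ^ 2 := by ring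
        _ ≤ (‖(P ^ 2 ^ k) x‖ * ‖x‖ ^ 2 ^ k) ^ 2 := by gcongr
        _ = ‖(P ^ 2 ^ k) x‖ ^ 2 * ‖x‖ ^ 2 ^ (k + 1) := by ring
        _ ≤ ‖(P ^ 2 ^ (k + 1)) x‖ * ‖x‖ * ‖x‖ ^ 2 ^ (k + 1) := by gcongr
        _ = _ := by ring

/-- The norm of a self-adjoint operator at a vector is controlled by the growth of the orbit. -/
theorem norm_apply_le_of_pow_growth {P : H →L[ℂ] H} (hP : IsSelfAdjoint P) {x : H} {C L : ℝ}
    (hL : 0 < L) (h : ∀ n, ‖(P ^ n) x‖ ≤ C * L ^ n) : ‖P x‖ ≤ L * ‖x‖ := by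
  rcases (norm_nonneg x).eq_or_lt with hx | hx
  · rw [norm_eq_zero.1 hx.symm]
    simp
  by_contra! hlt
  set r := ‖P x‖ / (L * ‖x‖) with hr
  have hr1 : 1 < r := (one_lt_div (by positivity)).2 hlt
  -- The constant `C` stays fixed while the exponent `2 ^ k` grows, which is impossible for a ratio
  -- `r > 1`.
  have hb : ∀ k : ℕ, r ^ 2 ^ k ≤ C / ‖x‖ := by
    intro k
    have h1 := norm_apply_pow_two_pow_le hP x k
    have h2 := h (2 ^ k)
    rw [hr, div_pow, mul_pow, div_le_div_iff₀ (by positivity) hx]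
    calc _ ≤ _ := h1
      _ ≤ C * L ^ 2 ^ k * ‖x‖ ^ 2 ^ k := by gcongr
      _ = _ := by ring
  have ht := (tendsto_pow_atTop_atTop_of_one_lt hr1).comp
    (tendsto_pow_atTop_atTop_of_one_lt (one_lt_two (α := ℕ)))
  obtain ⟨k, hk⟩ := (ht.eventually_gt_atTop (C / ‖x‖)).exists
  exact absurd (hb k) (not_le.2 hk)

/-- The constant `C` may depend on the vector, so the growth condition passes to linear
combinations. The resulting bound `‖P x‖ ≤ L * ‖x‖` no longer contains `C` and passes to the
closure. -/
theorem norm_le_of_pow_growth_of_dense_span {P : H →L[ℂ] H} (hP : IsSelfAdjoint P) {s : Set H}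
    (hs : Dense (Submodule.span ℂ s : Set H)) {L : ℝ} (hL : 0 < L)
    (h : ∀ x ∈ s, ∃ C, ∀ n, ‖(P ^ n) x‖ ≤ C * L ^ n) : ‖P‖ ≤ L := by
  have hspan : ∀ x ∈ Submodule.span ℂ s, ∃ C, ∀ n, ‖(P ^ n) x‖ ≤ C * L ^ n := by
    intro x hx
    induction hx using Submodule.span_induction with
    | mem x hx => exact h x hx
    | zero => exact ⟨0, by simp⟩
    | add x y _ _ hx hy =>
      obtain ⟨C, hC⟩ := hx
      obtain ⟨D, hD⟩ := hy
      refine ⟨C + D, fun n => ?_⟩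
      rw [map_add, add_mul]
      exact (norm_add_le _ _).trans (add_le_add (hC n) (hD n))
    | smul a x _ hx =>
      obtain ⟨C, hC⟩ := hx
      refine ⟨‖a‖ * C, fun n => ?_⟩
      rw [map_smul, norm_smul, mul_assoc]
      exact mul_le_mul_of_nonneg_left (hC n) (norm_nonneg a)
  refine P.opNorm_le_bound hL.le fun x => ?_
  refine hs.induction (P := fun x => ‖P x‖ ≤ L * ‖x‖) (fun y hy => ?_)
    (isClosed_le (by fun_prop) (by fun_prop)) x
  obtain ⟨C, hC⟩ := hspan y hy
  exact norm_apply_le_of_pow_growth hP hL hC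

end Hilbert

/-! ### Composition operators on kernels and the norm bound -/

theorem adjoint_kernel {φ : EuclideanSpace ℂ (Fin d) → EuclideanSpace ℂ (Fin d)}
    {T : Space d →L[ℂ] Space d} (hT : ∀ f z, T f z = f (φ z)) (z : EuclideanSpace ℂ (Fin d)) :
    ContinuousLinearMap.adjoint T (kernel z) = kernel (φ z) := by
  refine ext_inner_right ℂ fun f => ?_
  rw [ContinuousLinearMap.adjoint_inner_left, inner_kernel, inner_kernel, hT]

/-- Compare the norms of `kernel (φ z)`, the image of `kernel z` under the adjoint, and of `kernel
z`. The crude `‖T‖ ^ 2 ≤ exp (‖T‖ ^ 2)` avoids a logarithm. -/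
theorem norm_sq_apply_le {φ : EuclideanSpace ℂ (Fin d) → EuclideanSpace ℂ (Fin d)}
    {T : Space d →L[ℂ] Space d} (hT : ∀ f z, T f z = f (φ z)) :
    ∃ M, ∀ z, ‖φ z‖ ^ 2 ≤ ‖z‖ ^ 2 + M := by
  refine ⟨‖T‖ ^ 2, fun z => ?_⟩
  have h := (ContinuousLinearMap.adjoint T).le_opNorm (kernel z)
  rw [adjoint_kernel hT, LinearIsometryEquiv.norm_map] at h
  have h2 : Real.exp (‖φ z‖ ^ 2) ≤ Real.exp (‖T‖ ^ 2 + ‖z‖ ^ 2) := by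
    rw [Real.exp_add, ← norm_kernel_sq, ← norm_kernel_sq]
    calc ‖kernel (φ z)‖ ^ 2 ≤ (‖T‖ * ‖kernel z‖) ^ 2 := by gcongr
      _ = ‖T‖ ^ 2 * ‖kernel z‖ ^ 2 := by ring
      _ ≤ _ := by
        gcongr
        linarith [Real.add_one_le_exp (‖T‖ ^ 2)]
  linarith [Real.exp_le_exp.1 h2]

theorem apply_kernel {B : EuclideanSpace ℂ (Fin d) →L[ℂ] EuclideanSpace ℂ (Fin d)}
    {c : EuclideanSpace ℂ (Fin d)} {S : Space d →L[ℂ] Space d}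
    (hS : ∀ f z, S f z = f (B z + c)) (z : EuclideanSpace ℂ (Fin d)) :
    S (kernel z) =
      Complex.exp (inner ℂ z c) • kernel (ContinuousLinearMap.adjoint B z) := by
  refine Space.ext fun w => ?_
  rw [hS]
  change Complex.exp (inner ℂ z (B w + c)) =
    Complex.exp (inner ℂ z c) * Complex.exp (inner ℂ (ContinuousLinearMap.adjoint B z) w)
  rw [← Complex.exp_add, ContinuousLinearMap.adjoint_inner_left, inner_add_right, add_comm]

theorem norm_apply_kernel_sq_le {B : EuclideanSpace ℂ (Fin d) →L[ℂ] EuclideanSpace ℂ (Fin d)}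
    {c : EuclideanSpace ℂ (Fin d)} {S : Space d →L[ℂ] Space d}
    (hS : ∀ f z, S f z = f (B z + c)) {M : ℝ} (hM : ∀ z, ‖B z + c‖ ^ 2 ≤ ‖z‖ ^ 2 + M)
    (z : EuclideanSpace ℂ (Fin d)) :
    ‖S (kernel z)‖ ^ 2 ≤ Real.exp M * ‖kernel z‖ ^ 2 := by
  rw [apply_kernel hS, norm_smul, mul_pow, norm_kernel_sq, norm_kernel_sq, Complex.norm_exp,
    ← Real.exp_nat_mul, ← Real.exp_add, ← Real.exp_add, Real.exp_le_exp]
  set y := ContinuousLinearMap.adjoint B z with hy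
  have h1 := hM y
  -- With `y = B* z`, expanding this square gives `2‖y‖² + 2 Re⟪z, c⟫ ≤ ‖B y + c‖² + ‖z‖²`. Combined
  -- with `hM y` this is the claim on the exponents.
  have h2 : 0 ≤ ‖(B y + c) - z‖ ^ 2 := by positivity
  rw [@norm_sub_sq ℂ, inner_add_left, ← ContinuousLinearMap.adjoint_inner_right, ← hy,
    inner_self_eq_norm_sq_to_K, map_add] at h2
  have h3 : RCLike.re ((‖y‖ : ℂ) ^ 2) = ‖y‖ ^ 2 := by norm_cast
  have h4 : RCLike.re (inner ℂ c z) = (inner ℂ z c).re := inner_re_symm (𝕜 := ℂ) c z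
  simp only [Complex.coe_algebraMap] at h2
  rw [h3, h4] at h2
  push_cast
  linarith

/-- If `‖B z + c‖² - ‖z‖²` is bounded above by `M` then `exp (M / 2)` bounds the norm of the
composition operator with symbol `z ↦ B z + c`. -/
theorem norm_sq_le_exp {B : EuclideanSpace ℂ (Fin d) →L[ℂ] EuclideanSpace ℂ (Fin d)}
    {c : EuclideanSpace ℂ (Fin d)} {S : Space d →L[ℂ] Space d}
    (hS : ∀ f z, S f z = f (B z + c)) {M : ℝ} (hM : ∀ z, ‖B z + c‖ ^ 2 ≤ ‖z‖ ^ 2 + M) :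
    ‖S‖ ^ 2 ≤ Real.exp M := by
  set P : Space d →L[ℂ] Space d := S * ContinuousLinearMap.adjoint S with hP
  have hsa : IsSelfAdjoint P := IsSelfAdjoint.mul_star_self S
  -- The adjoint and `S` each contribute a factor `exp (M / 2)` on kernels, and the result is again
  -- a multiple of a kernel, so the estimate can be iterated.
  have hstep : ∀ z, ∃ (a : ℂ) (u : EuclideanSpace ℂ (Fin d)), P (kernel z) = a • kernel u ∧
      ‖P (kernel z)‖ ≤ Real.exp M * ‖kernel z‖ := by
    intro z
    have e : P (kernel z) = S (kernel (B z + c)) := by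
      rw [hP, mul_apply_eq_comp, adjoint_kernel hS]
    refine ⟨_, _, e.trans (apply_kernel hS _), ?_⟩
    refine le_of_sq_le_sq ?_ (by positivity)
    rw [e]
    calc _ ≤ _ := norm_apply_kernel_sq_le hS hM _
      _ ≤ Real.exp M * (Real.exp M * ‖kernel z‖ ^ 2) := by
        gcongr
        rw [norm_kernel_sq, norm_kernel_sq, ← Real.exp_add, Real.exp_le_exp]
        linarith [hM z]
      _ = _ := by ring
  have horbit : ∀ z n, ∃ (a : ℂ) (u : EuclideanSpace ℂ (Fin d)),
      (P ^ n) (kernel z) = a • kernel u ∧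
      ‖(P ^ n) (kernel z)‖ ≤ ‖kernel z‖ * Real.exp M ^ n := by
    intro z n
    induction n with
    | zero => exact ⟨1, z, by simp⟩
    | succ n ih =>
      obtain ⟨a, u, h, hn⟩ := ih
      obtain ⟨a', u', h', hn'⟩ := hstep u
      have e : (P ^ (n + 1)) (kernel z) = a • P (kernel u) := by
        rw [pow_succ', mul_apply_eq_comp, h, map_smul]
      refine ⟨a * a', u', by rw [e, h', smul_smul], ?_⟩
      rw [h, norm_smul] at hn
      rw [e, norm_smul]
      calc ‖a‖ * ‖P (kernel u)‖ ≤ ‖a‖ * (Real.exp M * ‖kernel u‖) := by gcongr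
        _ = Real.exp M * (‖a‖ * ‖kernel u‖) := by ring
        _ ≤ Real.exp M * (‖kernel z‖ * Real.exp M ^ n) := by gcongr
        _ = _ := by ring
  have hPn : ‖P‖ ≤ Real.exp M := by
    refine norm_le_of_pow_growth_of_dense_span hsa (dense_span_range_kernel d) (Real.exp_pos M) ?_
    rintro _ ⟨z, rfl⟩
    exact ⟨‖kernel z‖, fun n => (horbit z n).choose_spec.choose_spec.2⟩
  have hn : ‖P‖ = ‖S‖ * ‖S‖ := CStarRing.norm_self_mul_star (x := S)
  rw [pow_two, ← hn]
  exact hPn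

/-! ### Liouville: the symbol is affine -/

/-- An entire map of at most linear growth is affine. -/
theorem eq_fderiv_zero_add_of_norm_le {E F : Type*} [NormedAddCommGroup E] [NormedSpace ℂ E]
    [NormedAddCommGroup F] [NormedSpace ℂ F] [CompleteSpace F] {φ : E → F}
    (hφ : Differentiable ℂ φ) {C : ℝ} (hC : ∀ z, ‖φ z‖ ≤ ‖z‖ + C) (z : E) :
    φ z = fderiv ℂ φ 0 z + φ 0 := by
  set g : ℂ → F := fun t => φ (t • z) with hg
  have hgd : Differentiable ℂ g := hφ.comp (by fun_prop)
  -- The difference quotient at 0 along the complex line through `z` is entire and bounded, hence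
  -- constant. Its values at 1 and 0 are `φ z - φ 0` and the derivative in direction `z`.
  have hs : Differentiable ℂ (dslope g 0) := by
    rw [← differentiableOn_univ, Complex.differentiableOn_dslope Filter.univ_mem]
    exact hgd.differentiableOn
  have hb : Bornology.IsBounded (Set.range (dslope g 0)) := by
    obtain ⟨K, hK⟩ :=
      ((isCompact_closedBall (0 : ℂ) 1).image hs.continuous).isBounded.exists_norm_le
    refine isBounded_iff_forall_norm_le.2 ⟨max K (‖z‖ + C + ‖φ 0‖), ?_⟩
    rintro _ ⟨t, rfl⟩
    rcases le_or_gt ‖t‖ 1 with ht | ht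
    · exact (hK _ ⟨t, by simpa using ht, rfl⟩).trans (le_max_left _ _)
    · refine le_trans ?_ (le_max_right _ _)
      have ht0 : t ≠ 0 := by
        rintro rfl
        norm_num at ht
      have hC0 : 0 ≤ C := by simpa using (norm_nonneg _).trans (hC 0)
      rw [dslope_of_ne _ ht0, slope_def_module, sub_zero, norm_smul, norm_inv,
        inv_mul_le_iff₀ (by positivity)]
      calc ‖g t - g 0‖ ≤ ‖φ (t • z)‖ + ‖φ 0‖ := by simpa [hg] using norm_sub_le (g t) (g 0)
        _ ≤ ‖t‖ * ‖z‖ + C + ‖φ 0‖ := by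
          rw [← norm_smul]
          gcongr
          exact hC _
        _ ≤ ‖t‖ * (‖z‖ + C + ‖φ 0‖) := by nlinarith [norm_nonneg (φ 0)]
  have h := hs.apply_eq_apply_of_bounded hb 1 0
  have hder : HasDerivAt g (fderiv ℂ φ 0 z) 0 := by
    have h1 : HasDerivAt (fun t : ℂ => t • z) z 0 := by
      simpa using (hasDerivAt_id (0 : ℂ)).smul_const z
    have h2 : HasFDerivAt φ (fderiv ℂ φ 0) ((0 : ℂ) • z) := by
      rw [zero_smul]
      exact (hφ 0).hasFDerivAt
    exact h2.comp_hasDerivAt 0 h1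
  rw [dslope_same, hder.deriv, dslope_of_ne _ one_ne_zero, slope_def_module] at h
  simp only [hg, sub_zero, inv_one, one_smul, zero_smul] at h
  rw [← h, sub_add_cancel]

/-! ### Geometry of affine maps with bounded `‖A z + b‖² - ‖z‖²` -/

section Affine

variable {E : Type*} [NormedAddCommGroup E] [InnerProductSpace ℂ E]

theorem norm_smul_add_sq_le {A : E →L[ℂ] E} {b : E} {M : ℝ}
    (hM : ∀ z, ‖A z + b‖ ^ 2 ≤ ‖z‖ ^ 2 + M) (z : E) (t : ℝ) :
    t ^ 2 * ‖A z‖ ^ 2 + 2 * t * (inner ℂ (A z) b).re + ‖b‖ ^ 2 ≤ t ^ 2 * ‖z‖ ^ 2 + M := by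
  have h := hM ((t : ℂ) • z)
  rw [@norm_add_sq ℂ, map_smul, norm_smul, norm_smul, inner_smul_left] at h
  simp only [Complex.conj_ofReal, Complex.norm_real, Real.norm_eq_abs, mul_pow, sq_abs] at h
  have : RCLike.re ((t : ℂ) * inner ℂ (A z) b) = t * (inner ℂ (A z) b).re :=
    Complex.re_ofReal_mul _ _
  rw [this] at h
  linarith

theorem norm_apply_le_of_affine {A : E →L[ℂ] E} {b : E} {M : ℝ}
    (hM : ∀ z, ‖A z + b‖ ^ 2 ≤ ‖z‖ ^ 2 + M) (z : E) : ‖A z‖ ≤ ‖z‖ := by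
  by_contra! h
  have hpos : 0 < ‖A z‖ ^ 2 - ‖z‖ ^ 2 := by nlinarith [norm_nonneg z]
  set α := ‖A z‖ ^ 2 - ‖z‖ ^ 2 with hα
  have hMb : ‖b‖ ^ 2 ≤ M := by simpa using hM 0
  -- Averaging the inequalities for `t` and `-t` removes the cross term.
  have key : ∀ t : ℝ, t ^ 2 * α ≤ M := by
    intro t
    have h1 := norm_smul_add_sq_le hM z t
    have h2 := norm_smul_add_sq_le hM z (-t)
    rw [hα]
    nlinarith [sq_nonneg ‖b‖]
  have h3 := key (M / α + 1)
  have hM0 : 0 ≤ M := (sq_nonneg _).trans hMb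
  have h4 : 0 ≤ M / α := by positivity
  have h5 : M / α * α = M := div_mul_cancel₀ _ hpos.ne'
  nlinarith [mul_nonneg h4 hM0]

/-- When `A` preserves `‖z‖` the quadratic terms cancel along the line through `z`, and a nonzero
linear term would be unbounded. -/
theorem inner_eq_zero_of_affine {A : E →L[ℂ] E} {b : E} {M : ℝ}
    (hM : ∀ z, ‖A z + b‖ ^ 2 ≤ ‖z‖ ^ 2 + M) {z : E} (hz : ‖A z‖ = ‖z‖) :
    inner ℂ (A z) b = 0 := by
  have hre : ∀ w : E, ‖A w‖ = ‖w‖ → (inner ℂ (A w) b).re = 0 := by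
    intro w hw
    by_contra hne
    have h := norm_smul_add_sq_le hM w ((M + 1) / (2 * (inner ℂ (A w) b).re))
    have h2 : 2 * ((M + 1) / (2 * (inner ℂ (A w) b).re)) * (inner ℂ (A w) b).re = M + 1 := by
      field_simp
    rw [h2, hw] at h
    linarith [sq_nonneg ‖b‖]
  have h1 := hre z hz
  -- Rotating `z` by `I` turns the real part into the imaginary part.
  have h2 := hre (Complex.I • z) (by rw [map_smul, norm_smul, norm_smul, hz])
  rw [map_smul, inner_smul_left] at h2
  simp at h2
  exact Complex.ext h1 h2

theorem norm_pow_apply_le {A : E →L[ℂ] E} (hA : ∀ z, ‖A z‖ ≤ ‖z‖) (n : ℕ) (z : E) :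
    ‖(A ^ n) z‖ ≤ ‖z‖ := by
  induction n with
  | zero => simp
  | succ n ih =>
    rw [pow_succ', mul_apply_eq_comp]
    exact (hA _).trans ih

theorem antitone_norm_pow_apply {A : E →L[ℂ] E} (hA : ∀ z, ‖A z‖ ≤ ‖z‖) (z : E) :
    Antitone fun n : ℕ => ‖(A ^ n) z‖ :=
  antitone_nat_of_succ_le fun n => by
    rw [pow_succ', mul_apply_eq_comp]
    exact hA _

theorem iterate_affine_eq {A : E →L[ℂ] E} {b p : E} (hp : A p + b = p) (n : ℕ) (z : E) :
    (fun z => A z + b)^[n] z = (A ^ n) (z - p) + p := by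
  induction n with
  | zero => simp
  | succ n ih =>
    rw [Function.iterate_succ_apply', ih, pow_succ', mul_apply_eq_comp, map_add,
      add_assoc, hp]

variable [FiniteDimensional ℂ E]

/-- Since `⟪A* A z, z⟫ = ‖A z‖² = ‖z‖²` and `‖A* A z‖ ≤ ‖z‖`, expanding `‖A* A z - z‖²` leaves at
most 0. -/
theorem adjoint_apply_apply_eq_of_norm_eq {A : E →L[ℂ] E} (hA : ∀ z, ‖A z‖ ≤ ‖z‖) {z : E}
    (hz : ‖A z‖ = ‖z‖) : ContinuousLinearMap.adjoint A (A z) = z := by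
  have hA1 : ‖A‖ ≤ 1 := A.opNorm_le_bound zero_le_one fun z => by simpa using hA z
  have h : ‖ContinuousLinearMap.adjoint A (A z) - z‖ ^ 2 ≤ 0 := by
    rw [@norm_sub_sq ℂ, ContinuousLinearMap.adjoint_inner_left, inner_self_eq_norm_sq, hz]
    have h1 : ‖ContinuousLinearMap.adjoint A (A z)‖ ≤ ‖z‖ := by
      refine (ContinuousLinearMap.le_opNorm _ _).trans ?_
      rw [LinearIsometryEquiv.norm_map, hz]
      nlinarith [norm_nonneg z]
    nlinarith [norm_nonneg z, norm_nonneg (ContinuousLinearMap.adjoint A (A z))]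
  rw [← sub_eq_zero, ← norm_eq_zero]
  nlinarith [norm_nonneg (ContinuousLinearMap.adjoint A (A z) - z)]

/-- The subspace on which all powers of `A` are isometric. -/
def isometricPart (A : E →L[ℂ] E) : Submodule ℂ E :=
  ⨅ n : ℕ, LinearMap.ker
    ((ContinuousLinearMap.adjoint (A ^ n) * A ^ n - 1 : E →L[ℂ] E) : E →ₗ[ℂ] E)

theorem mem_isometricPart_iff_adjoint {A : E →L[ℂ] E} {z : E} :
    z ∈ isometricPart A ↔ ∀ n : ℕ, ContinuousLinearMap.adjoint (A ^ n) ((A ^ n) z) = z := by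
  simp only [isometricPart, Submodule.mem_iInf, LinearMap.mem_ker, ContinuousLinearMap.coe_coe,
    sub_apply, mul_apply_eq_comp, one_apply_eq_self, sub_eq_zero]

/-- Norm preservation is not visibly a linear condition; for a contraction it is equivalent to being
fixed by `(A ^ n)* A ^ n`, which is why `isometricPart` is built from kernels. -/
theorem mem_isometricPart {A : E →L[ℂ] E} (hA : ∀ z, ‖A z‖ ≤ ‖z‖) {z : E} :
    z ∈ isometricPart A ↔ ∀ n : ℕ, ‖(A ^ n) z‖ = ‖z‖ := by
  rw [mem_isometricPart_iff_adjoint]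
  refine forall_congr' fun n => ⟨fun h => ?_, fun h =>
    adjoint_apply_apply_eq_of_norm_eq (norm_pow_apply_le hA n) h⟩
  have h2 : inner ℂ ((A ^ n) z) ((A ^ n) z) = inner ℂ z z := by
    rw [← ContinuousLinearMap.adjoint_inner_left, h]
  rw [@norm_eq_sqrt_re_inner ℂ, h2, ← @norm_eq_sqrt_re_inner ℂ]

theorem apply_mem_isometricPart {A : E →L[ℂ] E} (hA : ∀ z, ‖A z‖ ≤ ‖z‖) {u : E}
    (hu : u ∈ isometricPart A) : A u ∈ isometricPart A := by
  rw [mem_isometricPart hA] at hu ⊢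
  intro n
  have h := hu (n + 1)
  rw [pow_succ, mul_apply_eq_comp] at h
  rw [h]
  simpa using (hu 1).symm

theorem norm_apply_of_mem_isometricPart {A : E →L[ℂ] E} (hA : ∀ z, ‖A z‖ ≤ ‖z‖) {u : E}
    (hu : u ∈ isometricPart A) : ‖A u‖ = ‖u‖ := by
  simpa using (mem_isometricPart hA).1 hu 1

/-- `A` is isometric, hence injective, on this invariant subspace; finite dimension makes it
surjective there. -/
theorem exists_apply_eq_of_mem_isometricPart {A : E →L[ℂ] E} (hA : ∀ z, ‖A z‖ ≤ ‖z‖) {u : E}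
    (hu : u ∈ isometricPart A) : ∃ w ∈ isometricPart A, A w = u := by
  let R : isometricPart A →ₗ[ℂ] isometricPart A :=
    (A : E →ₗ[ℂ] E).restrict fun x hx => apply_mem_isometricPart hA hx
  have hR : ∀ x, (R x : E) = A x := fun _ => rfl
  have hinj : Function.Injective R := by
    rw [injective_iff_map_eq_zero]
    intro x hx
    have h := norm_apply_of_mem_isometricPart hA x.2
    rw [← hR, hx] at h
    simpa using h.symm
  obtain ⟨w, hw⟩ := LinearMap.injective_iff_surjective.1 hinj ⟨u, hu⟩
  exact ⟨w, w.2, by rw [← hR, hw]⟩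

/-- Any `u` in the isometric part is `A w` with `w` in it and `A* A w = w`, so `⟪u, A v⟫ = ⟪w, v⟫ =
0`. -/
theorem apply_mem_orthogonal_isometricPart {A : E →L[ℂ] E} (hA : ∀ z, ‖A z‖ ≤ ‖z‖) {v : E}
    (hv : v ∈ (isometricPart A)ᗮ) : A v ∈ (isometricPart A)ᗮ := by
  rw [Submodule.mem_orthogonal] at hv ⊢
  intro u hu
  obtain ⟨w, hw, rfl⟩ := exists_apply_eq_of_mem_isometricPart hA hu
  rw [← ContinuousLinearMap.adjoint_inner_left,
    adjoint_apply_apply_eq_of_norm_eq hA (norm_apply_of_mem_isometricPart hA hw)]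
  exact hv w hw

theorem mem_orthogonal_isometricPart_of_affine {A : E →L[ℂ] E} {b : E} {M : ℝ}
    (hM : ∀ z, ‖A z + b‖ ^ 2 ≤ ‖z‖ ^ 2 + M) : b ∈ (isometricPart A)ᗮ := by
  have hA := norm_apply_le_of_affine hM
  rw [Submodule.mem_orthogonal]
  intro u hu
  obtain ⟨w, hw, rfl⟩ := exists_apply_eq_of_mem_isometricPart hA hu
  exact inner_eq_zero_of_affine hM (norm_apply_of_mem_isometricPart hA hw)

/-- A fixed vector of `A` lies in the isometric part, so `1 - A` is injective on the complement. By
finite dimension it is onto there, and the complement contains `b`. -/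
theorem exists_fixedPoint_of_affine {A : E →L[ℂ] E} {b : E} {M : ℝ}
    (hM : ∀ z, ‖A z + b‖ ^ 2 ≤ ‖z‖ ^ 2 + M) : ∃ p ∈ (isometricPart A)ᗮ, A p + b = p := by
  have hA := norm_apply_le_of_affine hM
  let R : (isometricPart A)ᗮ →ₗ[ℂ] (isometricPart A)ᗮ :=
    LinearMap.id - (A : E →ₗ[ℂ] E).restrict fun x hx => apply_mem_orthogonal_isometricPart hA hx
  have hR : ∀ x, (R x : E) = x - A x := fun _ => rfl
  have hinj : Function.Injective R := by
    rw [injective_iff_map_eq_zero]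
    intro x hx
    have h : A x = x := by
      rw [eq_comm, ← sub_eq_zero, ← hR, hx]
      rfl
    have hx' : (x : E) ∈ isometricPart A := by
      rw [mem_isometricPart hA]
      intro n
      congr 1
      induction n with
      | zero => simp
      | succ n ih => rw [pow_succ, mul_apply_eq_comp, h, ih]
    have h0 := x.2 x hx'
    rw [inner_self_eq_zero] at h0
    exact Subtype.ext h0
  obtain ⟨p, hp⟩ := LinearMap.injective_iff_surjective.1 hinj
    ⟨b, mem_orthogonal_isometricPart_of_affine hM⟩
  refine ⟨p, p.2, ?_⟩
  have h := hR p
  rw [hp] at h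
  rw [show b = p - A p from h, add_sub_cancel]

/-- Every unit vector of the complement is strictly shortened by some power of `A`. These conditions
are open and increase with the power, so by compactness one power serves the whole sphere. -/
theorem exists_pow_norm_le_of_mem_orthogonal {A : E →L[ℂ] E} (hA : ∀ z, ‖A z‖ ≤ ‖z‖) :
    ∃ N : ℕ, ∃ ρ : ℝ, 0 ≤ ρ ∧ ρ < 1 ∧ ∀ n ≥ N, ∀ v ∈ (isometricPart A)ᗮ,
      ‖(A ^ n) v‖ ≤ ρ * ‖v‖ := by
  have : ProperSpace E := FiniteDimensional.proper ℂ E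
  set K : Set E := Metric.sphere 0 1 ∩ (isometricPart A)ᗮ with hK
  have hKc : IsCompact K :=
    (isCompact_sphere _ _).inter_right (Submodule.isClosed_orthogonal _)
  have hcover : K ⊆ ⋃ n : ℕ, {x | ‖(A ^ n) x‖ < 1} := by
    rintro x ⟨hx1, hx2⟩
    by_contra hx
    simp only [Set.mem_iUnion, Set.mem_ofPred_eq, not_exists, not_lt] at hx
    rw [mem_sphere_zero_iff_norm] at hx1
    have hxU : x ∈ isometricPart A := (mem_isometricPart hA).2 fun n =>
      le_antisymm (norm_pow_apply_le hA n x) (hx1.trans_le (hx n))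
    have h0 := hx2 x hxU
    rw [inner_self_eq_zero] at h0
    rw [h0, norm_zero] at hx1
    exact zero_ne_one hx1
  have hmono : Monotone fun n : ℕ => {x | ‖(A ^ n) x‖ < 1} := fun m n hmn x hx =>
    (antitone_norm_pow_apply hA x hmn).trans_lt hx
  obtain ⟨N, hN⟩ := hKc.elim_directed_cover _
    (fun n => isOpen_lt (by fun_prop) continuous_const) hcover hmono.directed_le
  obtain ⟨ρ, hρ0, hρ1, hρ⟩ : ∃ ρ : ℝ, 0 ≤ ρ ∧ ρ < 1 ∧ ∀ x ∈ K, ‖(A ^ N) x‖ ≤ ρ := by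
    rcases K.eq_empty_or_nonempty with he | hne
    · exact ⟨0, le_rfl, one_pos, by simp [he]⟩
    · obtain ⟨x, hx, hmax⟩ := hKc.exists_isMaxOn hne
        (f := fun x => ‖(A ^ N) x‖) (by fun_prop)
      exact ⟨_, norm_nonneg _, hN hx, fun y hy => hmax hy⟩
  refine ⟨N, ρ, hρ0, hρ1, fun n hn v hv => ?_⟩
  refine (antitone_norm_pow_apply hA v hn).trans ?_
  rcases eq_or_ne v 0 with rfl | hv0
  · simp
  have hv' : 0 < ‖v‖ := norm_pos_iff.2 hv0
  have h := hρ (((‖v‖⁻¹ : ℝ) : ℂ) • v)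
    ⟨by simp [norm_smul, hv'.ne'], Submodule.smul_mem _ _ hv⟩
  rw [map_smul, norm_smul, Complex.norm_real, norm_inv, norm_norm, inv_mul_le_iff₀ hv'] at h
  simp only
  linarith

theorem norm_pow_add_sq {A : E →L[ℂ] E} (hA : ∀ z, ‖A z‖ ≤ ‖z‖) (n : ℕ) {u v : E}
    (hu : u ∈ isometricPart A) (hv : v ∈ (isometricPart A)ᗮ) :
    ‖(A ^ n) (u + v)‖ ^ 2 = ‖u‖ ^ 2 + ‖(A ^ n) v‖ ^ 2 := by
  rw [map_add, @norm_add_sq ℂ, (mem_isometricPart hA).1 hu n,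
    ← ContinuousLinearMap.adjoint_inner_left, mem_isometricPart_iff_adjoint.1 hu n, hv u hu]
  simp

theorem pow_apply_mem_isometricPart {A : E →L[ℂ] E} (hA : ∀ z, ‖A z‖ ≤ ‖z‖) (n : ℕ) {u : E}
    (hu : u ∈ isometricPart A) : (A ^ n) u ∈ isometricPart A := by
  induction n with
  | zero => simpa
  | succ n ih =>
    rw [pow_succ', mul_apply_eq_comp]
    exact apply_mem_isometricPart hA ih

/-- If `‖A z + b‖² - ‖z‖²` is bounded above then so are the corresponding quantities for the
iterates of `z ↦ A z + b`, uniformly. -/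
theorem exists_norm_sq_iterate_le {A : E →L[ℂ] E} {b : E} {M : ℝ}
    (hM : ∀ z, ‖A z + b‖ ^ 2 ≤ ‖z‖ ^ 2 + M) :
    ∃ M' : ℝ, ∃ N : ℕ, ∀ n ≥ N, ∀ z,
      ‖(fun z => A z + b)^[n] z‖ ^ 2 ≤ ‖z‖ ^ 2 + M' := by
  have hA := norm_apply_le_of_affine hM
  obtain ⟨p, hpV, hp⟩ := exists_fixedPoint_of_affine hM
  obtain ⟨N, ρ, hρ0, hρ1, hρ⟩ := exists_pow_norm_le_of_mem_orthogonal hA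
  have hδ : 0 < 1 - ρ ^ 2 := by nlinarith
  refine ⟨4 * ‖p‖ ^ 2 / (1 - ρ ^ 2), N, fun n hn z => ?_⟩
  rw [iterate_affine_eq hp]
  obtain ⟨u, hu, v, hv, huv⟩ := (isometricPart A).exists_add_mem_mem_orthogonal (z - p)
  have hz : z = (u + v) + p := by rw [← huv, sub_add_cancel]
  have hAu : inner ℂ ((A ^ n) u) p = 0 := hpV _ (pow_apply_mem_isometricPart hA n hu)
  have hup : inner ℂ u p = 0 := hpV u hu
  have huv0 : inner ℂ u v = 0 := hv u hu
  have e1 : ‖(A ^ n) (u + v) + p‖ ^ 2 =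
      ‖u‖ ^ 2 + ‖(A ^ n) v‖ ^ 2 + 2 * (inner ℂ ((A ^ n) v) p).re + ‖p‖ ^ 2 := by
    rw [@norm_add_sq ℂ, norm_pow_add_sq hA n hu hv, map_add, inner_add_left, hAu, zero_add]
    rfl
  have e2 : ‖z‖ ^ 2 = ‖u‖ ^ 2 + ‖v‖ ^ 2 + 2 * (inner ℂ v p).re + ‖p‖ ^ 2 := by
    rw [hz, @norm_add_sq ℂ, norm_add_sq (𝕜 := ℂ) u v, inner_add_left, hup, huv0, zero_add]
    simp
  rw [huv, e1, e2]
  have h1 : (inner ℂ ((A ^ n) v) p).re ≤ ‖v‖ * ‖p‖ :=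
    (Complex.re_le_norm _).trans ((norm_inner_le_norm _ _).trans
      (mul_le_mul_of_nonneg_right (norm_pow_apply_le hA n v) (norm_nonneg p)))
  have h2 : -(inner ℂ v p).re ≤ ‖v‖ * ‖p‖ :=
    (neg_le_abs _).trans ((Complex.abs_re_le_norm _).trans (norm_inner_le_norm _ _))
  have h3 : ‖(A ^ n) v‖ ^ 2 ≤ ρ ^ 2 * ‖v‖ ^ 2 := by
    rw [← mul_pow]
    have := hρ n hn v hv
    gcongr
  -- The constant comes from `((1 - ρ ^ 2) * ‖v‖ - 2 * ‖p‖) ^ 2 ≥ 0`: the loss of `(1 - ρ ^ 2) * ‖v‖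
  -- ^ 2` under `A ^ n` pays for the cross terms with `p`.
  have h4 : 4 * (‖v‖ * ‖p‖) ≤ (1 - ρ ^ 2) * ‖v‖ ^ 2 + 4 * ‖p‖ ^ 2 / (1 - ρ ^ 2) := by
    have h5 : (1 - ρ ^ 2) * (4 * ‖p‖ ^ 2 / (1 - ρ ^ 2)) = 4 * ‖p‖ ^ 2 := by
      field_simp
    refine le_of_mul_le_mul_left ?_ hδ
    rw [mul_add, h5]
    nlinarith [sq_nonneg ((1 - ρ ^ 2) * ‖v‖ - 2 * ‖p‖)]
  linarith

end Affine

/-! ### Spectral radius and norm of composition operators -/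

/-- An operator with bounded powers has spectral radius at most one. -/
theorem spectralRadius_le_one_of_pow_norm_le {A : Type*} [NormedRing A] [NormedAlgebra ℂ A]
    [CompleteSpace A] {a : A} {C : ℝ} {N : ℕ} (h : ∀ n ≥ N, ‖a ^ n‖ ≤ C) :
    spectralRadius ℂ a ≤ 1 := by
  have h1 := spectrum.pow_norm_pow_one_div_tendsto_nhds_spectralRadius a
  have hC : 0 < max C 1 := lt_max_of_lt_right one_pos
  have h2 : Filter.Tendsto (fun n : ℕ => ENNReal.ofReal (max C 1 ^ (1 / n : ℝ)))
      Filter.atTop (nhds 1) := by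
    have h3 : Filter.Tendsto (fun n : ℕ => max C 1 ^ (1 / n : ℝ)) Filter.atTop
        (nhds (max C 1 ^ (0 : ℝ))) :=
      tendsto_const_nhds.rpow tendsto_one_div_atTop_nhds_zero_nat (Or.inl hC.ne')
    rw [Real.rpow_zero] at h3
    simpa using ENNReal.tendsto_ofReal h3
  refine le_of_tendsto_of_tendsto h1 h2 ?_
  filter_upwards [Filter.eventually_ge_atTop N] with n hn
  refine ENNReal.ofReal_le_ofReal (Real.rpow_le_rpow (norm_nonneg _) ?_ (by positivity))
  exact (h n hn).trans (le_max_left _ _)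

theorem one_le_spectralRadius_of_mem {A : Type*} [NormedRing A] [NormedAlgebra ℂ A] {a : A}
    (h : (1 : ℂ) ∈ spectrum ℂ a) : 1 ≤ spectralRadius ℂ a := by
  simpa [spectralRadius] using le_iSup₂ (f := fun (k : ℂ) (_ : k ∈ spectrum ℂ a) =>
    (‖k‖₊ : ℝ≥0∞)) 1 h

theorem IsCompOp.apply {φ : EuclideanSpace ℂ (Fin d) → EuclideanSpace ℂ (Fin d)}
    {T : Space d →L[ℂ] Space d} (h : IsCompOp φ T) (f : Space d)
    (z : EuclideanSpace ℂ (Fin d)) : T f z = f (φ z) := by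
  obtain ⟨hdom, happ⟩ := LinearPMap.ext_iff.1 h
  have hf : f ∈ (compOp φ).domain := by
    rw [hdom]
    exact Submodule.mem_top
  have e : compOp φ ⟨f, hf⟩ = T f := happ (hg := Submodule.mem_top)
  rw [← e]
  rfl

theorem pow_apply_eq {φ : EuclideanSpace ℂ (Fin d) → EuclideanSpace ℂ (Fin d)}
    {T : Space d →L[ℂ] Space d} (hT : ∀ f z, T f z = f (φ z)) (n : ℕ) (f : Space d)
    (z : EuclideanSpace ℂ (Fin d)) : (T ^ n) f z = f (φ^[n] z) := by
  induction n generalizing z with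
  | zero => rfl
  | succ n ih =>
    rw [pow_succ', mul_apply_eq_comp, hT, ih, Function.iterate_succ_apply]

theorem kernel_zero_apply (w : EuclideanSpace ℂ (Fin d)) : kernel 0 w = 1 := by
  rw [kernel_apply, inner_zero_left, Complex.exp_zero]

theorem norm_kernel_zero : ‖kernel (0 : EuclideanSpace ℂ (Fin d))‖ = 1 := by
  have h := norm_kernel_sq (0 : EuclideanSpace ℂ (Fin d))
  rw [norm_zero, zero_pow two_ne_zero, Real.exp_zero] at h
  exact (pow_eq_one_iff_of_nonneg (norm_nonneg _) two_ne_zero).1 h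

theorem apply_kernel_zero {φ : EuclideanSpace ℂ (Fin d) → EuclideanSpace ℂ (Fin d)}
    {T : Space d →L[ℂ] Space d} (hT : ∀ f z, T f z = f (φ z)) : T (kernel 0) = kernel 0 :=
  Space.ext fun z => by rw [hT, kernel_zero_apply, kernel_zero_apply]

theorem one_mem_spectrum {φ : EuclideanSpace ℂ (Fin d) → EuclideanSpace ℂ (Fin d)}
    {T : Space d →L[ℂ] Space d} (hT : ∀ f z, T f z = f (φ z)) : (1 : ℂ) ∈ spectrum ℂ T := by
  rw [spectrum.mem_iff, map_one]
  rintro ⟨u, hu⟩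
  have h0 : (u : Space d →L[ℂ] Space d) (kernel 0) = 0 := by
    rw [hu, sub_apply, apply_kernel_zero hT, one_apply_eq_self,
      sub_self]
  have h1 : (↑u⁻¹ * ↑u : Space d →L[ℂ] Space d) (kernel 0) = kernel 0 := by
    rw [Units.inv_mul, one_apply_eq_self]
  rw [mul_apply_eq_comp, h0, map_zero] at h1
  have h2 := norm_kernel_zero (d := d)
  rw [← h1, norm_zero] at h2
  exact zero_ne_one h2

theorem spectralRadius_eq_one_of_affine
    {A : EuclideanSpace ℂ (Fin d) →L[ℂ] EuclideanSpace ℂ (Fin d)} {b : EuclideanSpace ℂ (Fin d)}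
    {T : Space d →L[ℂ] Space d} (hT : ∀ f z, T f z = f (A z + b)) :
    spectralRadius ℂ T = 1 := by
  refine le_antisymm ?_ (one_le_spectralRadius_of_mem (one_mem_spectrum hT))
  obtain ⟨M, hM⟩ := norm_sq_apply_le hT
  obtain ⟨M', N, hMN⟩ := exists_norm_sq_iterate_le hM
  obtain ⟨p, -, hp⟩ := exists_fixedPoint_of_affine hM
  -- The iterates are again affine, so `norm_sq_le_exp` applies to each power of `T`.
  have haff : ∀ n z, (fun z => A z + b)^[n] z = (A ^ n) z + (p - (A ^ n) p) := fun n z => by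
    rw [iterate_affine_eq hp, map_sub]
    abel
  refine spectralRadius_le_one_of_pow_norm_le (C := Real.exp M' + 1) (N := N) fun n hn => ?_
  have h : ‖T ^ n‖ ^ 2 ≤ Real.exp M' := by
    refine norm_sq_le_exp (B := A ^ n) (c := p - (A ^ n) p) (fun f z => ?_) fun z => ?_
    · rw [pow_apply_eq hT, haff]
    · rw [← haff]
      exact hMN n hn z
  nlinarith [sq_nonneg (‖T ^ n‖ - 1)]

theorem spectralRadius_eq_one {φ : EuclideanSpace ℂ (Fin d) → EuclideanSpace ℂ (Fin d)}
    {T : Space d →L[ℂ] Space d} (hφ : Differentiable ℂ φ) (hT : ∀ f z, T f z = f (φ z)) :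
    spectralRadius ℂ T = 1 := by
  obtain ⟨M, hM⟩ := norm_sq_apply_le hT
  have hC : ∀ z, ‖φ z‖ ≤ ‖z‖ + (|M| + 1) := fun z => by
    refine le_of_sq_le_sq ?_ (by positivity)
    nlinarith [hM z, le_abs_self M, abs_nonneg M, norm_nonneg z,
      mul_nonneg (norm_nonneg z) (abs_nonneg M), sq_nonneg |M|]
  refine spectralRadius_eq_one_of_affine (A := fderiv ℂ φ 0) (b := φ 0) fun f z => ?_
  rw [hT, eq_fderiv_zero_add_of_norm_le hφ hC z]

theorem one_le_norm {φ : EuclideanSpace ℂ (Fin d) → EuclideanSpace ℂ (Fin d)}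
    {T : Space d →L[ℂ] Space d} (hT : ∀ f z, T f z = f (φ z)) : 1 ≤ ‖T‖ := by
  have h := T.le_opNorm (kernel 0)
  rwa [apply_kernel_zero hT, norm_kernel_zero, mul_one] at h

theorem norm_eq_one_of_linear
    {A : EuclideanSpace ℂ (Fin d) →L[ℂ] EuclideanSpace ℂ (Fin d)}
    {T : Space d →L[ℂ] Space d} (hT : ∀ f z, T f z = f (A z)) : ‖T‖ = 1 := by
  refine le_antisymm ?_ (one_le_norm hT)
  have hT' : ∀ f z, T f z = f (A z + 0) := by simpa using hT
  obtain ⟨M, hM⟩ := norm_sq_apply_le hT'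
  have hA := norm_apply_le_of_affine hM
  have h : ‖T‖ ^ 2 ≤ Real.exp 0 := norm_sq_le_exp hT' fun z => by
    have := hA z
    rw [add_zero, add_zero]
    gcongr
  rw [Real.exp_zero] at h
  exact (sq_le_one_iff₀ (norm_nonneg _)).1 h

/-- The adjoint sends the unit vector `kernel 0` to `kernel (φ 0)`, whose squared norm `exp (‖φ 0‖ ^
2)` exceeds 1 unless `φ 0 = 0`. -/
theorem apply_zero_eq_zero_of_norm_le_one
    {φ : EuclideanSpace ℂ (Fin d) → EuclideanSpace ℂ (Fin d)}
    {T : Space d →L[ℂ] Space d} (hT : ∀ f z, T f z = f (φ z)) (h : ‖T‖ ≤ 1) : φ 0 = 0 := by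
  have h1 := (ContinuousLinearMap.adjoint T).le_opNorm (kernel 0)
  rw [adjoint_kernel hT, norm_kernel_zero, mul_one, LinearIsometryEquiv.norm_map] at h1
  have h2 : Real.exp (‖φ 0‖ ^ 2) ≤ 1 := by
    rw [← norm_kernel_sq]
    exact pow_le_one₀ (norm_nonneg _) (h1.trans h)
  rw [Real.exp_le_one_iff] at h2
  exact norm_eq_zero.1 (pow_eq_zero_iff two_ne_zero |>.1 (le_antisymm h2 (sq_nonneg _)))

end SegalBargmann

end

theorem theorem12p6 (d : ℕ) (hd : 1 ≤ d) :
    (∀ (φ : EuclideanSpace ℂ (Fin d) → EuclideanSpace ℂ (Fin d))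
        (T : SegalBargmann.Space d →L[ℂ] SegalBargmann.Space d),
      Differentiable ℂ φ → SegalBargmann.IsCompOp φ T → spectralRadius ℂ T = 1) ∧
    (∀ (A : EuclideanSpace ℂ (Fin d) →L[ℂ] EuclideanSpace ℂ (Fin d))
        (b : EuclideanSpace ℂ (Fin d))
        (T : SegalBargmann.Space d →L[ℂ] SegalBargmann.Space d),
      SegalBargmann.IsCompOp (fun z => A z + b) T →
        (SegalBargmann.IsNormaloid T ↔ b = 0) ∧
        (SegalBargmann.IsNormaloid T → spectralRadius ℂ T = 1 ∧ ‖T‖ = 1)) := by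

  refine ⟨fun φ T hφ hT => SegalBargmann.spectralRadius_eq_one hφ hT.apply, fun A b T hT => ?_⟩
  have hr := SegalBargmann.spectralRadius_eq_one_of_affine hT.apply
  have hiff : SegalBargmann.IsNormaloid T ↔ ‖T‖ = 1 := by
    rw [SegalBargmann.IsNormaloid, hr, eq_comm, ← ofReal_norm, ENNReal.ofReal_eq_one]
  refine ⟨⟨fun h => ?_, ?_⟩, fun h => ⟨hr, hiff.1 h⟩⟩
  · simpa using SegalBargmann.apply_zero_eq_zero_of_norm_le_one hT.apply (hiff.1 h).le
  · rintro rfl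
    exact hiff.2 (SegalBargmann.norm_eq_one_of_linear fun f z => by simpa using hT.apply f z)
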